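/- Let $N\ge 3$, let $\Omega\subset\mathbb{R}^N$ be open and bounded, and let $0<\alpha\le\beta$. Let $M(x,s)=(m_{ij}(x,s))_{i,j=1}^N$, where $m_{ij}:\Omega\times\mathbb{R}\to\mathbb{R}$ are Carath\'eodory functions (measurable in $x$ for every $s$, continuous in $s$ for a.e. $x$), satisfy $$\alpha|\zeta|^2\le M(x,s)\zeta\cdot\zeta,\qquad |M(x,s)|\le\beta\qquad\text{for a.e. }x\in\Omega,\ \forall (s,\zeta)\in\mathbb{R}\times\mathbb{R}^N ,$$ where $|M(x,s)|$ is the Euclidean operator norm. Let $g:\Omega\times(0,\infty)\to\mathbb{R}$ be a Carath\'eodory function and $h:(0,\infty)\to[0,\infty)$ a continuous function with $$0\le h(s)\le g(x,s)\qquad\text{for a.e. }x\in\Omega,\ \forall s>0 .$$ For $R>0$ put $h_R(s)=\frac1R\,h\!\left(\frac sR\right)$. Suppose that there is $R_0>0$ such that for every $R\in(0,R_0)$ $$\lim_{s\to0^+}h_R(s)=+\infty,\qquad \lim_{s\to0^+}\int_s^1\sqrt{h_R(t)}\,dt=+\infty,$$ and the limit $$\lim_{s\to0^+}\sqrt{h_R(s)}\;\exp\left(\int_1^s\sqrt{h_R(t)}\,dt\right)$$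 exists and is a finite number $\ge0$. Let $f\in L^q(\Omega)$ for some $q\in(N/2,\infty]$, with $f\ge0$ a.e. in $\Omega$ and $f\not\equiv0$ (that is, $f$ is not a.e. zero in $\Omega$). Then the problem $$-\operatorname{div}(M(x,u)\nabla u)+g(x,u)|\nabla u|^2=f\ \text{ in }\Omega,\qquad u=0\ \text{ on }\partial\Omega,$$ has no finite energy solution. Here a finite energy solution is a function $u\in H^1_0(\Omega)$ with $u>0$ a.e. in $\Omega$ and $g(x,u)|\nabla u|^2\in L^1(\Omega)$ such that $$\int_\Omega M(x,u)\nabla u\cdot\nabla\phi+\int_\Omega g(x,u)|\nabla u|^2\phi=\int_\Omega f\phi\qquad\text{for all } 0\le\phi\in C_c^\infty(\Omega).$$ -/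

import Mathlib

open MeasureTheory Set Filter Topology
open scoped ContDiff ENNReal

/-- `C_c^∞(Ω)`: smooth functions on `ℝ^N` with compact support contained in `Ω`. -/
def IsTestFunction {N : ℕ} (Ω : Set (EuclideanSpace ℝ (Fin N)))
    (φ : EuclideanSpace ℝ (Fin N) → ℝ) : Prop :=
  ContDiff ℝ ∞ φ ∧ HasCompactSupport φ ∧ tsupport φ ⊆ Ω

/-- `u ∈ W^{1,1}_loc(Ω)` with weak gradient `G` (for `Ω` open): both are locally integrable on `Ω`
and `∫_Ω u ∇φ = - ∫_Ω φ G` for every `φ ∈ C_c^∞(Ω)`. -/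
structure IsWeakGradient {N : ℕ} (Ω : Set (EuclideanSpace ℝ (Fin N)))
    (u : EuclideanSpace ℝ (Fin N) → ℝ)
    (G : EuclideanSpace ℝ (Fin N) → EuclideanSpace ℝ (Fin N)) : Prop where
  locallyIntegrable : LocallyIntegrableOn u Ω
  locallyIntegrable_grad : LocallyIntegrableOn G Ω
  integral_eq : ∀ φ : EuclideanSpace ℝ (Fin N) → ℝ, IsTestFunction Ω φ →
    ∫ x in Ω, u x • gradient φ x = - ∫ x in Ω, φ x • G x

/-- `u ∈ W_0^{1,p}(Ω)` with weak gradient `G`: `u` and `G` are in `L^p(Ω)` and `u` is the limit of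
functions in `C_c^∞(Ω)` in the norm of `W^{1,p}(Ω)`. For `p = 2` this is `H_0^1(Ω)`. -/
structure IsW1pZero {N : ℕ} (p : ℝ≥0∞) (Ω : Set (EuclideanSpace ℝ (Fin N)))
    (u : EuclideanSpace ℝ (Fin N) → ℝ)
    (G : EuclideanSpace ℝ (Fin N) → EuclideanSpace ℝ (Fin N)) : Prop where
  memLp : MemLp u p (volume.restrict Ω)
  memLp_grad : MemLp G p (volume.restrict Ω)
  isWeakGradient : IsWeakGradient Ω u G
  exists_approx : ∃ φ : ℕ → EuclideanSpace ℝ (Fin N) → ℝ,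
    (∀ n, IsTestFunction Ω (φ n)) ∧
    Tendsto (fun n => eLpNorm (fun x => φ n x - u x) p (volume.restrict Ω)) atTop (𝓝 0) ∧
    Tendsto (fun n => eLpNorm (fun x => gradient (φ n) x - G x) p (volume.restrict Ω))
      atTop (𝓝 0)

/-- A matrix-valued function `M(x,s)`, `x ∈ Ω`, `s ∈ ℝ`, with Carathéodory entries. -/
structure IsCaratheodoryMatrix {N : ℕ} (Ω : Set (EuclideanSpace ℝ (Fin N)))
    (M : EuclideanSpace ℝ (Fin N) → ℝ → Matrix (Fin N) (Fin N) ℝ) : Prop where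
  aemeasurable : ∀ i j s, AEMeasurable (fun x => M x s i j) (volume.restrict Ω)
  continuous : ∀ i j, ∀ᵐ x ∂(volume.restrict Ω), Continuous (fun s => M x s i j)

/-- `α |ζ|² ≤ M(x,s) ζ · ζ` and `|M(x,s)| ≤ β` (Euclidean operator norm) for a.e. `x ∈ Ω` and all
`s ∈ ℝ`, `ζ ∈ ℝ^N`. -/
def IsElliptic {N : ℕ} (Ω : Set (EuclideanSpace ℝ (Fin N)))
    (M : EuclideanSpace ℝ (Fin N) → ℝ → Matrix (Fin N) (Fin N) ℝ) (α β : ℝ) : Prop :=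
  ∀ᵐ x ∂(volume.restrict Ω), ∀ (s : ℝ),
    (∀ ζ : EuclideanSpace ℝ (Fin N),
      α * ‖ζ‖ ^ 2 ≤ inner ℝ (Matrix.toEuclideanCLM (𝕜 := ℝ) (M x s) ζ) ζ) ∧
    ‖Matrix.toEuclideanCLM (𝕜 := ℝ) (M x s)‖ ≤ β

/-- A real function `g(x,s)`, `x ∈ Ω`, `s ∈ (0,∞)`, which is Carathéodory. -/
structure IsCaratheodoryPos {N : ℕ} (Ω : Set (EuclideanSpace ℝ (Fin N)))
    (g : EuclideanSpace ℝ (Fin N) → ℝ → ℝ) : Prop where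
  aemeasurable : ∀ s, 0 < s → AEMeasurable (fun x => g x s) (volume.restrict Ω)
  continuousOn : ∀ᵐ x ∂(volume.restrict Ω), ContinuousOn (g x) (Ioi 0)

/-- `∫_Ω M(x,u) ∇u · ∇φ + ∫_Ω g(x,u) |∇u|² φ`, where `G` stands for `∇u`. -/
noncomputable def weakForm {N : ℕ} (Ω : Set (EuclideanSpace ℝ (Fin N)))
    (M : EuclideanSpace ℝ (Fin N) → ℝ → Matrix (Fin N) (Fin N) ℝ)
    (g : EuclideanSpace ℝ (Fin N) → ℝ → ℝ)
    (u : EuclideanSpace ℝ (Fin N) → ℝ)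
    (G : EuclideanSpace ℝ (Fin N) → EuclideanSpace ℝ (Fin N))
    (φ : EuclideanSpace ℝ (Fin N) → ℝ) : ℝ :=
  (∫ x in Ω, inner ℝ (Matrix.toEuclideanCLM (𝕜 := ℝ) (M x (u x)) (G x)) (gradient φ x)) +
    ∫ x in Ω, g x (u x) * ‖G x‖ ^ 2 * φ x

/-- `u`, with weak gradient `G`, is a supersolution of
`-div(M(x,u)∇u) + g(x,u)|∇u|² = f` in `Ω`. -/
structure IsSupersolution {N : ℕ} (Ω : Set (EuclideanSpace ℝ (Fin N)))
    (M : EuclideanSpace ℝ (Fin N) → ℝ → Matrix (Fin N) (Fin N) ℝ)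
    (g : EuclideanSpace ℝ (Fin N) → ℝ → ℝ) (f : EuclideanSpace ℝ (Fin N) → ℝ)
    (u : EuclideanSpace ℝ (Fin N) → ℝ)
    (G : EuclideanSpace ℝ (Fin N) → EuclideanSpace ℝ (Fin N)) : Prop where
  isWeakGradient : IsWeakGradient Ω u G
  pos : ∀ᵐ x ∂(volume.restrict Ω), 0 < u x
  locallyIntegrable : LocallyIntegrableOn (fun x => g x (u x) * ‖G x‖ ^ 2) Ω
  le_weakForm : ∀ φ : EuclideanSpace ℝ (Fin N) → ℝ, IsTestFunction Ω φ → (∀ x, 0 ≤ φ x) →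
    ∫ x in Ω, f x * φ x ≤ weakForm Ω M g u G φ

/-- `u`, with weak gradient `G`, is a subsolution of
`-div(M(x,u)∇u) + g(x,u)|∇u|² = f` in `Ω`. -/
structure IsSubsolution {N : ℕ} (Ω : Set (EuclideanSpace ℝ (Fin N)))
    (M : EuclideanSpace ℝ (Fin N) → ℝ → Matrix (Fin N) (Fin N) ℝ)
    (g : EuclideanSpace ℝ (Fin N) → ℝ → ℝ) (f : EuclideanSpace ℝ (Fin N) → ℝ)
    (u : EuclideanSpace ℝ (Fin N) → ℝ)
    (G : EuclideanSpace ℝ (Fin N) → EuclideanSpace ℝ (Fin N)) : Prop where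
  isWeakGradient : IsWeakGradient Ω u G
  pos : ∀ᵐ x ∂(volume.restrict Ω), 0 < u x
  locallyIntegrable : LocallyIntegrableOn (fun x => g x (u x) * ‖G x‖ ^ 2) Ω
  weakForm_le : ∀ φ : EuclideanSpace ℝ (Fin N) → ℝ, IsTestFunction Ω φ → (∀ x, 0 ≤ φ x) →
    weakForm Ω M g u G φ ≤ ∫ x in Ω, f x * φ x

/-- `u ∈ W_0^{1,1}(Ω)`, with weak gradient `G`, is a distributional solution of
`-div(M(x,u)∇u) + g(x,u)|∇u|² = f` in `Ω`, `u = 0` on `∂Ω`. -/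
structure IsDistributionalSolution {N : ℕ} (Ω : Set (EuclideanSpace ℝ (Fin N)))
    (M : EuclideanSpace ℝ (Fin N) → ℝ → Matrix (Fin N) (Fin N) ℝ)
    (g : EuclideanSpace ℝ (Fin N) → ℝ → ℝ) (f : EuclideanSpace ℝ (Fin N) → ℝ)
    (u : EuclideanSpace ℝ (Fin N) → ℝ)
    (G : EuclideanSpace ℝ (Fin N) → EuclideanSpace ℝ (Fin N)) : Prop where
  isW11Zero : IsW1pZero 1 Ω u G
  integrable : IntegrableOn (fun x => g x (u x) * ‖G x‖ ^ 2) Ω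
  isSupersolution : IsSupersolution Ω M g f u G
  isSubsolution : IsSubsolution Ω M g f u G

/-- `u` is a finite energy solution: a distributional solution that belongs to `H_0^1(Ω)`. -/
def IsFiniteEnergySolution {N : ℕ} (Ω : Set (EuclideanSpace ℝ (Fin N)))
    (M : EuclideanSpace ℝ (Fin N) → ℝ → Matrix (Fin N) (Fin N) ℝ)
    (g : EuclideanSpace ℝ (Fin N) → ℝ → ℝ) (f : EuclideanSpace ℝ (Fin N) → ℝ)
    (u : EuclideanSpace ℝ (Fin N) → ℝ) : Prop :=
  ∃ G : EuclideanSpace ℝ (Fin N) → EuclideanSpace ℝ (Fin N),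
    IsDistributionalSolution Ω M g f u G ∧ IsW1pZero 2 Ω u G

/-- `h(s) → +∞` and `∫_s^1 √h → +∞` as `s → 0⁺`. -/
def NonintegrabilityCondition (h : ℝ → ℝ) : Prop :=
  Tendsto h (𝓝[>] 0) atTop ∧
  Tendsto (fun s : ℝ => ∫ t in s..1, √(h t)) (𝓝[>] 0) atTop

/-- `√h(s) exp(∫_1^s √h)` has a finite limit `h₀ ≥ 0` as `s → 0⁺`. -/
def LimitCondition (h : ℝ → ℝ) : Prop :=
  ∃ h₀ : ℝ, 0 ≤ h₀ ∧
    Tendsto (fun s : ℝ => √(h s) * Real.exp (∫ t in (1 : ℝ)..s, √(h t))) (𝓝[>] 0) (𝓝 h₀)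

/-- The rescaling `h_R(s) = h(s/R)/R`. -/
noncomputable def rescale (h : ℝ → ℝ) (R s : ℝ) : ℝ := (1 / R) * h (s / R)

/-! The obstruction lies in the finiteness of the energy term. Since `h(u)|∇u|² ≤ g(x,u)|∇u|² ∈
L¹(Ω)`, a primitive `ζ` of `√h` formally satisfies `|∇ζ(u)|² = h(u)|∇u|²`; but `√h` is not
integrable at `0`, so the primitive vanishing at `0` is infinite on `(0,∞)`. To make this rigorous,
truncate `√h` to bounded continuous `ξ n` with primitives `ζ n`, `ζ n 0 = 0`. Poincaré's inequality
(`IsW1pZero.eLpNorm_comp_le`) bounds `ζ n (u)` in `L²(Ω)` uniformly in `n`, while `ζ n (u) → ∞`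
wherever `u > 0`. By Fatou, `Ω` is null (`IsW1pZero.volume_eq_zero_of_nonintegrable`), which
contradicts `f ≢ 0`. -/

open NNReal in
/-- Poincaré's inequality for `ζ ∘ u`, where `u ∈ H¹₀(Ω)` and `ζ` is a `C¹` function with bounded
derivative `ξ` and `ζ 0 = 0`. -/
theorem IsW1pZero.eLpNorm_comp_le {N : ℕ} (hN : 3 ≤ N)
    {Ω : Set (EuclideanSpace ℝ (Fin N))} (hΩb : Bornology.IsBounded Ω)
    {u : EuclideanSpace ℝ (Fin N) → ℝ} {G : EuclideanSpace ℝ (Fin N) → EuclideanSpace ℝ (Fin N)}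
    (hu : IsW1pZero 2 Ω u G) {ζ ξ : ℝ → ℝ} (hζ : ∀ t, HasDerivAt ζ (ξ t) t)
    (hξ : Continuous ξ) (hζ0 : ζ 0 = 0) {B : ℝ} (hB : ∀ t, |ξ t| ≤ B) :
    eLpNorm (fun x => ζ (u x)) 2 (volume.restrict Ω) ≤
      eLpNormLESNormFDerivOfLeConst ℝ (volume : Measure (EuclideanSpace ℝ (Fin N))) Ω 2 2 *
        eLpNorm (fun x => ξ (u x) • G x) 2 (volume.restrict Ω) := by
  obtain ⟨φ, hφ, hφu, hφG⟩ := hu.exists_approx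
  have hζc : Continuous ζ := continuous_iff_continuousAt.2 fun t => (hζ t).continuousAt
  have hζd : deriv ζ = ξ := funext fun t => (hζ t).deriv
  have hζC : ContDiff ℝ 1 ζ :=
    contDiff_one_iff_deriv.2 ⟨fun t => (hζ t).differentiableAt, by rwa [hζd]⟩
  have hφC : ∀ n, ContDiff ℝ 1 (φ n) := fun n => (hφ n).1.of_le (by exact_mod_cast le_top)
  have hφgrad : ∀ n, Continuous (gradient (φ n)) := fun n =>
    (InnerProductSpace.toDual ℝ _).symm.continuous.comp ((hφC n).continuous_fderiv one_ne_zero)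
  set μ := volume.restrict Ω with hμ
  set C := eLpNormLESNormFDerivOfLeConst ℝ
    (volume : Measure (EuclideanSpace ℝ (Fin N))) Ω 2 2 with hC
  have smooth : ∀ n, eLpNorm (fun x => ζ (φ n x)) 2 μ ≤
      C * eLpNorm (fun x => ξ (φ n x) • gradient (φ n) x) 2 μ := by
    intro n
    have hsuppφ : ∀ x, x ∉ Ω → x ∉ tsupport (φ n) := fun x hx h => hx ((hφ n).2.2 h)
    have hsupp : (fun x => ζ (φ n x)).support ⊆ Ω := by
      intro x hx
      by_contra hxΩ
      exact hx (by simp [image_eq_zero_of_notMem_tsupport (hsuppφ x hxΩ), hζ0])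
    have hder : ∀ x, fderiv ℝ (fun x => ζ (φ n x)) x = ξ (φ n x) • fderiv ℝ (φ n) x := fun x =>
      ((hζ _).comp_hasFDerivAt x
        ((hφC n).differentiable one_ne_zero x).hasFDerivAt).fderiv
    have hsupp' : (fderiv ℝ fun x => ζ (φ n x)).support ⊆ Ω := by
      intro x hx
      by_contra hxΩ
      refine hx ?_
      have : x ∉ tsupport (fderiv ℝ (φ n)) := fun h =>
        hsuppφ x hxΩ (tsupport_fderiv_subset ℝ h)
      rw [hder, image_eq_zero_of_notMem_tsupport this, smul_zero]
    -- The Sobolev inequality with both exponents `2` needs `2 < N`; this is where `3 ≤ N` enters.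
    have key := eLpNorm_le_eLpNorm_fderiv_of_le
      (μ := (volume : Measure (EuclideanSpace ℝ (Fin N)))) (p := 2) (q := 2)
      (hζC.comp (hφC n)) hsupp one_le_two
      (by rw [finrank_euclideanSpace_fin]; exact_mod_cast hN)
      (by simp) hΩb
    rw [Function.comp_def, ← eLpNorm_restrict_eq_of_support_subset hsupp] at key
    refine key.trans_eq ?_
    rw [← eLpNorm_restrict_eq_of_support_subset (ε := EuclideanSpace ℝ (Fin N) →L[ℝ] ℝ) hsupp']
    congr 1
    refine eLpNorm_congr_norm_ae (.of_forall fun x => ?_)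
    simp [hder, gradient, norm_smul]
  have hmeas : TendstoInMeasure μ φ atTop u :=
    tendstoInMeasure_of_tendsto_eLpNorm two_ne_zero
      (fun n => (hφC n).continuous.aestronglyMeasurable) hu.memLp.1 hφu
  obtain ⟨ns, hns, hae⟩ := hmeas.exists_seq_tendsto_ae
  have hξG : ∀ {v : EuclideanSpace ℝ (Fin N) → ℝ}, AEStronglyMeasurable v μ →
      AEStronglyMeasurable (fun x => ξ (v x) • G x) μ := fun hv =>
    (hξ.comp_aestronglyMeasurable hv).smul hu.memLp_grad.1
  -- With `G` fixed, only `ξ (φ n)` varies: it converges a.e. along the subsequence, and `B‖G‖`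
  -- dominates.
  have hlim : Tendsto (fun n => eLpNorm (fun x => ξ (φ (ns n) x) • G x) 2 μ) atTop
      (𝓝 (eLpNorm (fun x => ξ (u x) • G x) 2 μ)) := by
    simp_rw [eLpNorm_eq_lintegral_rpow_enorm_toReal two_ne_zero ENNReal.ofNat_ne_top]
    refine (ENNReal.continuous_rpow_const.tendsto _).comp ?_
    refine tendsto_lintegral_of_dominated_convergence'
      (fun x => ‖B • G x‖ₑ ^ (2 : ℝ≥0∞).toReal) (fun n => ?_) (fun n => .of_forall fun x => ?_) ?_ ?_
    · exact (hξG (hφC _).continuous.aestronglyMeasurable).enorm.pow_const _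
    · beta_reduce
      gcongr ?_ ^ _
      rw [enorm_smul, enorm_smul]
      gcongr
      exact enorm_le_iff_norm_le.2 ((hB _).trans (le_abs_self _))
    · exact (lintegral_rpow_enorm_lt_top_of_eLpNorm_lt_top two_ne_zero ENNReal.ofNat_ne_top
        (hu.memLp_grad.const_smul B).2).ne
    · filter_upwards [hae] with x hx
      exact (ENNReal.continuous_rpow_const.tendsto _).comp
        (((hξ.tendsto _).comp hx).smul_const _).enorm
  -- Split `ξ(φ)∇φ = ξ(φ)(∇φ - G) + ξ(φ)G`; the first term is at most `B‖∇φ - G‖` in norm and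
  -- vanishes in the limit.
  have hbound : ∀ n, eLpNorm (fun x => ζ (φ (ns n) x)) 2 μ ≤
      C * (ENNReal.ofReal B * eLpNorm (fun x => gradient (φ (ns n)) x - G x) 2 μ +
        eLpNorm (fun x => ξ (φ (ns n) x) • G x) 2 μ) := by
    intro n
    refine (smooth (ns n)).trans ?_
    gcongr
    have hm1 : AEStronglyMeasurable
        (fun x => ξ (φ (ns n) x) • (gradient (φ (ns n)) x - G x)) μ :=
      ((hξ.comp (hφC _).continuous).aestronglyMeasurable).smul
        ((hφgrad _).aestronglyMeasurable.sub hu.memLp_grad.1)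
    have hadd := eLpNorm_add_le hm1 (hξG (hφC (ns n)).continuous.aestronglyMeasurable) one_le_two
    have heq : (fun x => ξ (φ (ns n) x) • (gradient (φ (ns n)) x - G x)) +
        (fun x => ξ (φ (ns n) x) • G x) = fun x => ξ (φ (ns n) x) • gradient (φ (ns n)) x := by
      ext1 x
      simp [smul_sub]
    rw [heq] at hadd
    refine hadd.trans ?_
    gcongr
    refine eLpNorm_le_mul_eLpNorm_of_ae_le_mul (.of_forall fun x => ?_) 2
    rw [norm_smul]
    gcongr
    exact hB _
  have hrhs : Tendsto (fun n => C * (ENNReal.ofReal B *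
        eLpNorm (fun x => gradient (φ (ns n)) x - G x) 2 μ +
        eLpNorm (fun x => ξ (φ (ns n) x) • G x) 2 μ)) atTop
      (𝓝 (C * (ENNReal.ofReal B * 0 + eLpNorm (fun x => ξ (u x) • G x) 2 μ))) :=
    ENNReal.Tendsto.const_mul ((ENNReal.Tendsto.const_mul (hφG.comp hns.tendsto_atTop)
      (.inr ENNReal.ofReal_ne_top)).add hlim) (.inr ENNReal.coe_ne_top)
  rw [mul_zero, zero_add] at hrhs
  calc eLpNorm (fun x => ζ (u x)) 2 μ
      ≤ atTop.liminf fun n => eLpNorm (fun x => ζ (φ (ns n) x)) 2 μ :=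
        Lp.eLpNorm_lim_le_liminf_eLpNorm
          (fun n => (hζc.comp (hφC _).continuous).aestronglyMeasurable) _
          (hae.mono fun x hx => (hζc.tendsto _).comp hx)
    _ ≤ atTop.liminf _ := liminf_le_liminf (.of_forall hbound)
    _ = _ := hrhs.liminf_eq

/-- If `u ∈ H¹₀(Ω)` is positive, `h(u)|∇u|²` is bounded by an integrable function and `√h` is not
integrable near `0`, then `Ω` is a null set. -/
theorem IsW1pZero.volume_eq_zero_of_nonintegrable {N : ℕ} (hN : 3 ≤ N)
    {Ω : Set (EuclideanSpace ℝ (Fin N))} (hΩb : Bornology.IsBounded Ω)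
    {u : EuclideanSpace ℝ (Fin N) → ℝ} {G : EuclideanSpace ℝ (Fin N) → EuclideanSpace ℝ (Fin N)}
    (hu : IsW1pZero 2 Ω u G) (hpos : ∀ᵐ x ∂(volume.restrict Ω), 0 < u x)
    {h : ℝ → ℝ} (hcont : ContinuousOn h (Ioi 0)) (hnonneg : ∀ s, 0 < s → 0 ≤ h s)
    {b : ℝ} (hb : 0 < b)
    (hint : Tendsto (fun s : ℝ => ∫ t in s..b, √(h t)) (𝓝[>] 0) atTop)
    {F : EuclideanSpace ℝ (Fin N) → ℝ} (hF : IntegrableOn F Ω)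
    (hle : ∀ᵐ x ∂(volume.restrict Ω), h (u x) * ‖G x‖ ^ 2 ≤ F x) :
    volume Ω = 0 := by
  -- The cap `n * max 0 (min t 1)` vanishes for `t ≤ 0`, which makes `ξ n` continuous across `0`
  -- whatever `h` does there, and it is at most `n`.
  set ξ : ℕ → ℝ → ℝ := fun n t => min (√(h t)) (n * max 0 (min t 1)) with hξdef
  have hξ0 : ∀ n t, 0 ≤ ξ n t := fun n t => by positivity
  have hξh : ∀ n t, ξ n t ≤ √(h t) := fun n t => min_le_left _ _
  have hξn : ∀ n t, ξ n t ≤ n := fun n t => (min_le_right _ _).trans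
    (mul_le_of_le_one_right (Nat.cast_nonneg n) (max_le zero_le_one (min_le_right _ _)))
  have hξc : ∀ n, Continuous (ξ n) := by
    intro n
    have hc : Continuous fun t : ℝ => (n : ℝ) * max 0 (min t 1) := by fun_prop
    refine continuous_iff_continuousAt.2 fun t => ?_
    rcases lt_or_ge 0 t with ht | ht
    · exact ((hcont.continuousAt (Ioi_mem_nhds ht)).sqrt).min hc.continuousAt
    · have h0 : (n : ℝ) * max 0 (min t 1) = 0 := by
        rw [max_eq_left ((min_le_left _ _).trans ht), mul_zero]
      have hξt : ξ n t = 0 := le_antisymm ((min_le_right _ _).trans_eq h0) (hξ0 n t)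
      rw [ContinuousAt, hξt]
      refine squeeze_zero (hξ0 n) (fun s => min_le_right _ _) ?_
      simpa [h0] using hc.tendsto t
  set ζ : ℕ → ℝ → ℝ := fun n s => ∫ t in (0 : ℝ)..s, ξ n t with hζdef
  have hζd : ∀ n t, HasDerivAt (ζ n) (ξ n t) t := fun n t => (hξc n).integral_hasStrictDerivAt 0 t
    |>.hasDerivAt
  have hζtop : ∀ s, 0 < s → Tendsto (fun n => ζ n s) atTop atTop := by
    intro s hs
    have hsq : ∀ {a c : ℝ}, 0 < a → 0 < c → IntervalIntegrable (fun t => √(h t)) volume a c :=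
      fun {a c} ha hc => ContinuousOn.intervalIntegrable
        ((hcont.mono fun t ht => (lt_min ha hc).trans_le ht.1).sqrt)
    refine tendsto_atTop.2 fun A => ?_
    have hev : ∀ᶠ δ in 𝓝[>] (0 : ℝ), A - (∫ t in b..s, √(h t)) ≤ ∫ t in δ..b, √(h t) :=
      hint.eventually_ge_atTop _
    obtain ⟨δ, hδA, hδ0, hδs⟩ := (hev.and (Ioo_mem_nhdsGT (lt_min hs one_pos))).exists
    have hδs' : δ < s := hδs.trans_le (min_le_left _ _)
    have hδ1 : δ < 1 := hδs.trans_le (min_le_right _ _)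
    obtain ⟨K, hK⟩ := isCompact_Icc.exists_bound_of_continuousOn
      (hcont.mono fun t (ht : t ∈ Icc δ s) => hδ0.trans_le ht.1).sqrt
    -- For such `n` the cap is at least `nδ ≥ K ≥ √h` on `[δ, s]`, so the truncation is inactive
    -- there.
    filter_upwards [eventually_ge_atTop ⌈K / δ⌉₊] with n hn
    have hKn : K ≤ n * δ := (div_le_iff₀ hδ0).1 (Nat.ceil_le.1 hn)
    have heq : ∫ t in δ..s, ξ n t = ∫ t in δ..s, √(h t) := by
      refine intervalIntegral.integral_congr fun t ht => ?_
      rw [uIcc_of_le hδs'.le] at ht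
      refine min_eq_left (((le_abs_self _).trans (hK t ht)).trans (hKn.trans ?_))
      gcongr
      exact le_max_of_le_right (le_min ht.1 hδ1.le)
    have hsplit : ζ n s = (∫ t in (0 : ℝ)..δ, ξ n t) + ∫ t in δ..s, ξ n t :=
      (intervalIntegral.integral_add_adjacent_intervals ((hξc n).intervalIntegrable _ _)
        ((hξc n).intervalIntegrable _ _)).symm
    have hsplit' := intervalIntegral.integral_add_adjacent_intervals (hsq hδ0 hb) (hsq hb hs)
    have h0 : 0 ≤ ∫ t in (0 : ℝ)..δ, ξ n t :=
      intervalIntegral.integral_nonneg hδ0.le fun t _ => hξ0 n t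
    linarith
  set μ := volume.restrict Ω with hμ
  set K : ℝ≥0∞ := eLpNormLESNormFDerivOfLeConst ℝ
    (volume : Measure (EuclideanSpace ℝ (Fin N))) Ω 2 2 * eLpNorm (fun x => √(F x)) 2 μ with hK
  have hFnn : 0 ≤ᵐ[μ] F := by
    filter_upwards [hle, hpos] with x hx hp
    exact (mul_nonneg (hnonneg _ hp) (sq_nonneg _)).trans hx
  have hFL : MemLp (fun x => √(F x)) 2 μ := by
    refine (memLp_two_iff_integrable_sq hF.1.aemeasurable.sqrt.aestronglyMeasurable).2 ?_
    refine hF.congr ?_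
    filter_upwards [hFnn] with x hx
    exact (Real.sq_sqrt hx).symm
  have hKtop : K ≠ ⊤ := ENNReal.mul_ne_top ENNReal.coe_ne_top hFL.2.ne
  have hζK : ∀ n, eLpNorm (fun x => ζ n (u x)) 2 μ ≤ K := by
    intro n
    refine (hu.eLpNorm_comp_le hN hΩb (hζd n) (hξc n) intervalIntegral.integral_same
      (B := n) fun t => ?_).trans ?_
    · rw [abs_of_nonneg (hξ0 n t)]
      exact hξn n t
    · rw [hK]
      gcongr
      refine eLpNorm_mono_ae ?_
      filter_upwards [hle, hpos] with x hx hp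
      rw [norm_smul, Real.norm_of_nonneg (hξ0 _ _), Real.norm_of_nonneg (Real.sqrt_nonneg _)]
      refine Real.le_sqrt_of_sq_le (le_trans ?_ hx)
      rw [mul_pow]
      gcongr
      exact (Real.le_sqrt (hξ0 _ _) (hnonneg _ hp)).1 (hξh n _)
  have hconst : ∀ A : ℕ, eLpNorm (fun _ : EuclideanSpace ℝ (Fin N) => (A : ℝ)) 2 μ ≤ K := by
    intro A
    -- Cutting `ζ n (u)` at height `A` gives a finite a.e. limit, the constant `A`, to which Fatou
    -- applies.
    refine (Lp.eLpNorm_lim_le_liminf_eLpNorm (f := fun n x => min (ζ n (u x)) A)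
      (fun n => ?_) _ ?_).trans ?_
    · have : Continuous (ζ n) := continuous_iff_continuousAt.2 fun t => (hζd n t).continuousAt
      exact (this.min continuous_const).comp_aestronglyMeasurable hu.memLp.1
    · filter_upwards [hpos] with x hx
      refine tendsto_const_nhds.congr' ?_
      filter_upwards [(hζtop _ hx).eventually_ge_atTop (A : ℝ)] with n hn
      exact (min_eq_right hn).symm
    · refine (liminf_le_liminf (v := fun _ => K) (.of_forall fun n => ?_)).trans_eq
        (liminf_const K)
      refine (eLpNorm_mono_ae ?_).trans (hζK n)
      filter_upwards [hpos] with x hx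
      have hζ0 : 0 ≤ ζ n (u x) := intervalIntegral.integral_nonneg hx.le fun t _ => hξ0 n t
      rw [Real.norm_of_nonneg (le_min hζ0 (Nat.cast_nonneg A)), Real.norm_of_nonneg hζ0]
      exact min_le_left _ _
  by_contra hvol
  have hμ0 : μ ≠ 0 := fun h0 => hvol (Measure.restrict_eq_zero.1 h0)
  set m : ℝ≥0∞ := μ univ ^ (1 / (2 : ℝ≥0∞).toReal) with hm
  have hm0 : m ≠ 0 := by simp [hm, hμ0]
  obtain ⟨A, hA⟩ := ENNReal.exists_nat_mul_gt hm0 hKtop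
  refine absurd (hconst A) (not_le.2 ?_)
  rw [eLpNorm_const _ two_ne_zero hμ0]
  simpa [hm] using hA

/-- Substituting `t = Rτ` gives `∫_{Rs}^1 √h_R = √R ∫_s^{1/R} √h`, with `√R` appearing as `√(1/R) *
R`. -/
theorem NonintegrabilityCondition.tendsto_integral_sqrt {h : ℝ → ℝ} {R : ℝ} (hR : 0 < R)
    (hh : NonintegrabilityCondition (rescale h R)) :
    Tendsto (fun s : ℝ => ∫ t in s..1 / R, √(h t)) (𝓝[>] 0) atTop := by
  have hscale : Tendsto (fun s : ℝ => R * s) (𝓝[>] 0) (𝓝[>] 0) := by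
    refine tendsto_nhdsWithin_iff.2 ⟨?_, ?_⟩
    · have : Tendsto (fun s : ℝ => R * s) (𝓝 0) (𝓝 (R * 0)) := (continuous_const_mul R).tendsto 0
      rw [mul_zero] at this
      exact this.mono_left nhdsWithin_le_nhds
    · filter_upwards [self_mem_nhdsWithin] with s hs
      exact mul_pos hR hs
  have hc : 0 < √(1 / R) * R := by positivity
  refine ((hh.2.comp hscale).const_mul_atTop (inv_pos.2 hc)).congr fun s => ?_
  have hsqrt : ∀ t, √(rescale h R t) = √(1 / R) * √(h (t / R)) := fun t =>
    Real.sqrt_mul (one_div_pos.2 hR).le _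
  simp only [Function.comp_apply, hsqrt]
  rw [intervalIntegral.integral_const_mul,
    intervalIntegral.integral_comp_div (fun t => √(h t)) hR.ne', smul_eq_mul, ← mul_assoc,
    ← mul_assoc, mul_assoc _ √(1 / R) R, inv_mul_cancel₀ hc.ne', one_mul,
    mul_div_cancel_left₀ _ hR.ne']

theorem mainTheorem10 {N : ℕ} (hN : 3 ≤ N)
    (Ω : Set (EuclideanSpace ℝ (Fin N))) (hΩo : IsOpen Ω) (hΩb : Bornology.IsBounded Ω)
    (M : EuclideanSpace ℝ (Fin N) → ℝ → Matrix (Fin N) (Fin N) ℝ)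
    (hM : IsCaratheodoryMatrix Ω M)
    (α β : ℝ) (hα : 0 < α) (hαβ : α ≤ β) (hMell : IsElliptic Ω M α β)
    (g : EuclideanSpace ℝ (Fin N) → ℝ → ℝ) (hg : IsCaratheodoryPos Ω g)
    (h : ℝ → ℝ) (hcont : ContinuousOn h (Ioi 0)) (hnonneg : ∀ s, 0 < s → 0 ≤ h s)
    (hhg : ∀ᵐ x ∂(volume.restrict Ω), ∀ s, 0 < s → h s ≤ g x s)
    (R₀ : ℝ) (hR₀ : 0 < R₀)
    (hR : ∀ R ∈ Ioo 0 R₀,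
      NonintegrabilityCondition (rescale h R) ∧ LimitCondition (rescale h R))
    (q : ℝ≥0∞) (hq : (N : ℝ≥0∞) / 2 < q)
    (f : EuclideanSpace ℝ (Fin N) → ℝ) (hfq : MemLp f q (volume.restrict Ω))
    (hf0 : ∀ᵐ x ∂(volume.restrict Ω), 0 ≤ f x)
    (hfne : ¬ f =ᵐ[volume.restrict Ω] 0) :
    ¬ ∃ u : EuclideanSpace ℝ (Fin N) → ℝ, IsFiniteEnergySolution Ω M g f u := by
  rintro ⟨u, G, hsol, hu⟩
  -- A single scale suffices; `R₀ / 2` is an arbitrary choice in `(0, R₀)`.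
  have hR2 : 0 < R₀ / 2 := half_pos hR₀
  have hpos := hsol.isSupersolution.pos
  have hvol : volume Ω = 0 :=
    hu.volume_eq_zero_of_nonintegrable hN hΩb hpos hcont hnonneg (one_div_pos.2 hR2)
      ((hR _ ⟨hR2, half_lt_self hR₀⟩).1.tendsto_integral_sqrt hR2) hsol.integrable <| by
        filter_upwards [hhg, hpos] with x hx hp
        gcongr
        exact hx _ hp
  exact hfne (by simp [Measure.restrict_eq_zero.2 hvol, EventuallyEq])
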